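/- Let $\mathcal L$ be an arbitrary set of propositional letters, and let $\mathcal P$ be the set of formulae generated from $\mathcal L$ by the constants $\mathrm I$, $\mathrm O$ and the binary connectives $\times$, $+$. The free dicartesian category $\mathcal D$ generated by $\mathcal L$ has the formulae of $\mathcal P$ as objects. Its arrows are equivalence classes of terms built by composition $\circ$ and the operations $f\times g:A\times C\to B\times D$, $f+g:A+C\to B+D$ (for $f:A\to B$, $g:C\to D$) from the atomic terms $$\mathbf 1_A:A\to A,\quad k_A:A\to \mathrm I,\quad l_A:\mathrm O\to A,\quad k^1_{A,B}:A\times B\to A,\quad k^2_{A,B}:A\times B\to B,$$ $$l^1_{A,B}:A\to A+B,\quad l^2_{A,B}:B\to A+B,\quad w_A:A\to A\times A,\quad m_A:A+A\to A .$$ Equality of terms is the least congruence satisfying, for $i\in\{1,2\}$, the category equations and $$\mathbf 1_A\times\mathbf 1_B=\mathbf 1_{A\times B},\quad (g_1\circ g_2)\times(f_1\circ f_2)=(g_1\times f_1)\circ(g_2\times f_2),\quad k^i_{B_1,B_2}\circ(f_1\times f_2)=f_i\circ k^i_{A_1,A_2},$$ $$w_B\circ f=(f\times f)\circ w_A,\quad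 k^i_{A,A}\circ w_A=\mathbf 1_A,\quad (k^1_{A,B}\times k^2_{A,B})\circ w_{A\times B}=\mathbf 1_{A\times B},$$ $$f=k_A\ \text{ for all } f:A\to\mathrm I,\qquad k^1_{\mathrm O,\mathrm O}=k^2_{\mathrm O,\mathrm O},$$ $$\mathbf 1_A+\mathbf 1_B=\mathbf 1_{A+B},\quad (g_1\circ g_2)+(f_1\circ f_2)=(g_1+f_1)\circ(g_2+f_2),\quad (f_1+f_2)\circ l^i_{A_1,A_2}=l^i_{B_1,B_2}\circ f_i,$$ $$f\circ m_A=m_B\circ(f+f),\quad m_A\circ l^i_{A,A}=\mathbf 1_A,\quad m_{A+B}\circ(l^1_{A,B}+l^2_{A,B})=\mathbf 1_{A+B},$$ $$f=l_A\ \text{ for all } f:\mathrm O\to A,\qquad l^1_{\mathrm I,\mathrm I}=l^2_{\mathrm I,\mathrm I}.$$ The free sesquicartesian category $\mathcal S$ generated by $\mathcal L$ has as objects the formulae of $\mathcal P$ in which $\mathrm I$ does not occur. Its terms are built in the same way, using only such formulae and no atomic terms $k_A$. Equality of its terms is the least congruence on these terms satisfying the same equations, without $f=k_A$ and $l^1_{\mathrm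 I,\mathrm I}=l^2_{\mathrm I,\mathrm I}$. Then $\mathcal S$ is a full subcategory of $\mathcal D$. That is, the canonical functor $\mathcal S\to\mathcal D$, which sends each formula to itself and the class of each term to the class of the same term, is injective on objects, has as image on objects exactly the formulae in which $\mathrm I$ does not occur, and is full and faithful. -/

import Mathlib

/-- The propositional language generated by the set `L` of propositional letters, the constants
`I` and `O`, and the binary connectives `×` and `+`. -/
inductive Formula (L : Type*) where
  | letter (p : L) : Formula L
  | I : Formula L
  | O : Formula L
  | prod (A B : Formula L) : Formula L
  | sum (A B : Formula L) : Formula L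

namespace Formula

/-- The constant `I` does not occur in the formula. -/
def IFree {L : Type*} : Formula L → Prop
  | letter _ => True
  | I => False
  | O => True
  | prod A B => A.IFree ∧ B.IFree
  | sum A B => A.IFree ∧ B.IFree

end Formula

section

open Formula

/-- The arrow terms `f : A → B` of the free dicartesian category; `comp g f` is `g ∘ f`. -/
inductive DTerm {L : Type*} : Formula L → Formula L → Type _ where
  | one (A : Formula L) : DTerm A A
  | k (A : Formula L) : DTerm A I
  | l (A : Formula L) : DTerm O A
  | k1 (A B : Formula L) : DTerm (prod A B) A
  | k2 (A B : Formula L) : DTerm (prod A B) B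
  | l1 (A B : Formula L) : DTerm A (sum A B)
  | l2 (A B : Formula L) : DTerm B (sum A B)
  | w (A : Formula L) : DTerm A (prod A A)
  | m (A : Formula L) : DTerm (sum A A) A
  | comp {A B C : Formula L} (g : DTerm B C) (f : DTerm A B) : DTerm A C
  | times {A B C D : Formula L} (f : DTerm A B) (g : DTerm C D) : DTerm (prod A C) (prod B D)
  | plus {A B C D : Formula L} (f : DTerm A B) (g : DTerm C D) : DTerm (sum A C) (sum B D)

open DTerm in
/-- Equality of arrow terms in the free dicartesian category: the least congruence containing
the listed equations. -/
inductive DEq {L : Type*} : {A B : Formula L} → DTerm A B → DTerm A B → Prop where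
  | refl {A B : Formula L} (f : DTerm A B) : DEq f f
  | symm {A B : Formula L} {f g : DTerm A B} : DEq f g → DEq g f
  | trans {A B : Formula L} {f g h : DTerm A B} : DEq f g → DEq g h → DEq f h
  | comp_congr {A B C : Formula L} {g g' : DTerm B C} {f f' : DTerm A B} :
      DEq g g' → DEq f f' → DEq (comp g f) (comp g' f')
  | times_congr {A B C D : Formula L} {f f' : DTerm A B} {g g' : DTerm C D} :
      DEq f f' → DEq g g' → DEq (times f g) (times f' g')
  | plus_congr {A B C D : Formula L} {f f' : DTerm A B} {g g' : DTerm C D} :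
      DEq f f' → DEq g g' → DEq (plus f g) (plus f' g')
  | one_comp {A B : Formula L} (f : DTerm A B) : DEq (comp (one B) f) f
  | comp_one {A B : Formula L} (f : DTerm A B) : DEq (comp f (one A)) f
  | assoc {A B C D : Formula L} (h : DTerm C D) (g : DTerm B C) (f : DTerm A B) :
      DEq (comp h (comp g f)) (comp (comp h g) f)
  | times_one (A B : Formula L) : DEq (times (one A) (one B)) (one (prod A B))
  | times_comp {A B C A' B' C' : Formula L} (g₁ : DTerm B C) (g₂ : DTerm A B)
      (f₁ : DTerm B' C') (f₂ : DTerm A' B') :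
      DEq (times (comp g₁ g₂) (comp f₁ f₂)) (comp (times g₁ f₁) (times g₂ f₂))
  | k1_nat {A₁ A₂ B₁ B₂ : Formula L} (f₁ : DTerm A₁ B₁) (f₂ : DTerm A₂ B₂) :
      DEq (comp (k1 B₁ B₂) (times f₁ f₂)) (comp f₁ (k1 A₁ A₂))
  | k2_nat {A₁ A₂ B₁ B₂ : Formula L} (f₁ : DTerm A₁ B₁) (f₂ : DTerm A₂ B₂) :
      DEq (comp (k2 B₁ B₂) (times f₁ f₂)) (comp f₂ (k2 A₁ A₂))
  | w_nat {A B : Formula L} (f : DTerm A B) : DEq (comp (w B) f) (comp (times f f) (w A))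
  | k1_w (A : Formula L) : DEq (comp (k1 A A) (w A)) (one A)
  | k2_w (A : Formula L) : DEq (comp (k2 A A) (w A)) (one A)
  | k_w (A B : Formula L) :
      DEq (comp (times (k1 A B) (k2 A B)) (w (prod A B))) (one (prod A B))
  | k_uniq {A : Formula L} (f : DTerm A I) : DEq f (k A)
  | kO : DEq (k1 O O : DTerm (L := L) (prod O O) O) (k2 O O)
  | plus_one (A B : Formula L) : DEq (plus (one A) (one B)) (one (sum A B))
  | plus_comp {A B C A' B' C' : Formula L} (g₁ : DTerm B C) (g₂ : DTerm A B)
      (f₁ : DTerm B' C') (f₂ : DTerm A' B') :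
      DEq (plus (comp g₁ g₂) (comp f₁ f₂)) (comp (plus g₁ f₁) (plus g₂ f₂))
  | l1_nat {A₁ A₂ B₁ B₂ : Formula L} (f₁ : DTerm A₁ B₁) (f₂ : DTerm A₂ B₂) :
      DEq (comp (plus f₁ f₂) (l1 A₁ A₂)) (comp (l1 B₁ B₂) f₁)
  | l2_nat {A₁ A₂ B₁ B₂ : Formula L} (f₁ : DTerm A₁ B₁) (f₂ : DTerm A₂ B₂) :
      DEq (comp (plus f₁ f₂) (l2 A₁ A₂)) (comp (l2 B₁ B₂) f₂)
  | m_nat {A B : Formula L} (f : DTerm A B) : DEq (comp f (m A)) (comp (m B) (plus f f))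
  | m_l1 (A : Formula L) : DEq (comp (m A) (l1 A A)) (one A)
  | m_l2 (A : Formula L) : DEq (comp (m A) (l2 A A)) (one A)
  | m_l (A B : Formula L) :
      DEq (comp (m (sum A B)) (plus (l1 A B) (l2 A B))) (one (sum A B))
  | l_uniq {A : Formula L} (f : DTerm O A) : DEq f (l A)
  | lI : DEq (l1 I I : DTerm (L := L) I (sum I I)) (l2 I I)

/-- The arrow terms of the free sesquicartesian category: only formulae in which `I` does not
occur are used, and the terms `k_A : A → I` are absent. -/
inductive STerm {L : Type*} : Formula L → Formula L → Type _ where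
  | one (A : Formula L) (hA : A.IFree) : STerm A A
  | l (A : Formula L) (hA : A.IFree) : STerm O A
  | k1 (A B : Formula L) (hA : A.IFree) (hB : B.IFree) : STerm (prod A B) A
  | k2 (A B : Formula L) (hA : A.IFree) (hB : B.IFree) : STerm (prod A B) B
  | l1 (A B : Formula L) (hA : A.IFree) (hB : B.IFree) : STerm A (sum A B)
  | l2 (A B : Formula L) (hA : A.IFree) (hB : B.IFree) : STerm B (sum A B)
  | w (A : Formula L) (hA : A.IFree) : STerm A (prod A A)
  | m (A : Formula L) (hA : A.IFree) : STerm (sum A A) A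
  | comp {A B C : Formula L} (g : STerm B C) (f : STerm A B) : STerm A C
  | times {A B C D : Formula L} (f : STerm A B) (g : STerm C D) : STerm (prod A C) (prod B D)
  | plus {A B C D : Formula L} (f : STerm A B) (g : STerm C D) : STerm (sum A C) (sum B D)

open STerm in
/-- Equality of arrow terms in the free sesquicartesian category: the least congruence
containing the listed equations. -/
inductive SEq {L : Type*} : {A B : Formula L} → STerm A B → STerm A B → Prop where
  | refl {A B : Formula L} (f : STerm A B) : SEq f f
  | symm {A B : Formula L} {f g : STerm A B} : SEq f g → SEq g f
  | trans {A B : Formula L} {f g h : STerm A B} : SEq f g → SEq g h → SEq f h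
  | comp_congr {A B C : Formula L} {g g' : STerm B C} {f f' : STerm A B} :
      SEq g g' → SEq f f' → SEq (comp g f) (comp g' f')
  | times_congr {A B C D : Formula L} {f f' : STerm A B} {g g' : STerm C D} :
      SEq f f' → SEq g g' → SEq (times f g) (times f' g')
  | plus_congr {A B C D : Formula L} {f f' : STerm A B} {g g' : STerm C D} :
      SEq f f' → SEq g g' → SEq (plus f g) (plus f' g')
  | one_comp {A B : Formula L} (hB : B.IFree) (f : STerm A B) : SEq (comp (one B hB) f) f
  | comp_one {A B : Formula L} (hA : A.IFree) (f : STerm A B) : SEq (comp f (one A hA)) f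
  | assoc {A B C D : Formula L} (h : STerm C D) (g : STerm B C) (f : STerm A B) :
      SEq (comp h (comp g f)) (comp (comp h g) f)
  | times_one (A B : Formula L) (hA : A.IFree) (hB : B.IFree) :
      SEq (times (one A hA) (one B hB)) (one (prod A B) ⟨hA, hB⟩)
  | times_comp {A B C A' B' C' : Formula L} (g₁ : STerm B C) (g₂ : STerm A B)
      (f₁ : STerm B' C') (f₂ : STerm A' B') :
      SEq (times (comp g₁ g₂) (comp f₁ f₂)) (comp (times g₁ f₁) (times g₂ f₂))
  | k1_nat {A₁ A₂ B₁ B₂ : Formula L} (hA₁ : A₁.IFree) (hA₂ : A₂.IFree) (hB₁ : B₁.IFree)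
      (hB₂ : B₂.IFree) (f₁ : STerm A₁ B₁) (f₂ : STerm A₂ B₂) :
      SEq (comp (k1 B₁ B₂ hB₁ hB₂) (times f₁ f₂)) (comp f₁ (k1 A₁ A₂ hA₁ hA₂))
  | k2_nat {A₁ A₂ B₁ B₂ : Formula L} (hA₁ : A₁.IFree) (hA₂ : A₂.IFree) (hB₁ : B₁.IFree)
      (hB₂ : B₂.IFree) (f₁ : STerm A₁ B₁) (f₂ : STerm A₂ B₂) :
      SEq (comp (k2 B₁ B₂ hB₁ hB₂) (times f₁ f₂)) (comp f₂ (k2 A₁ A₂ hA₁ hA₂))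
  | w_nat {A B : Formula L} (hA : A.IFree) (hB : B.IFree) (f : STerm A B) :
      SEq (comp (w B hB) f) (comp (times f f) (w A hA))
  | k1_w (A : Formula L) (hA : A.IFree) : SEq (comp (k1 A A hA hA) (w A hA)) (one A hA)
  | k2_w (A : Formula L) (hA : A.IFree) : SEq (comp (k2 A A hA hA) (w A hA)) (one A hA)
  | k_w (A B : Formula L) (hA : A.IFree) (hB : B.IFree) :
      SEq (comp (times (k1 A B hA hB) (k2 A B hA hB)) (w (prod A B) ⟨hA, hB⟩))
        (one (prod A B) ⟨hA, hB⟩)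
  | kO : SEq (k1 O O trivial trivial : STerm (L := L) (prod O O) O) (k2 O O trivial trivial)
  | plus_one (A B : Formula L) (hA : A.IFree) (hB : B.IFree) :
      SEq (plus (one A hA) (one B hB)) (one (sum A B) ⟨hA, hB⟩)
  | plus_comp {A B C A' B' C' : Formula L} (g₁ : STerm B C) (g₂ : STerm A B)
      (f₁ : STerm B' C') (f₂ : STerm A' B') :
      SEq (plus (comp g₁ g₂) (comp f₁ f₂)) (comp (plus g₁ f₁) (plus g₂ f₂))
  | l1_nat {A₁ A₂ B₁ B₂ : Formula L} (hA₁ : A₁.IFree) (hA₂ : A₂.IFree) (hB₁ : B₁.IFree)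
      (hB₂ : B₂.IFree) (f₁ : STerm A₁ B₁) (f₂ : STerm A₂ B₂) :
      SEq (comp (plus f₁ f₂) (l1 A₁ A₂ hA₁ hA₂)) (comp (l1 B₁ B₂ hB₁ hB₂) f₁)
  | l2_nat {A₁ A₂ B₁ B₂ : Formula L} (hA₁ : A₁.IFree) (hA₂ : A₂.IFree) (hB₁ : B₁.IFree)
      (hB₂ : B₂.IFree) (f₁ : STerm A₁ B₁) (f₂ : STerm A₂ B₂) :
      SEq (comp (plus f₁ f₂) (l2 A₁ A₂ hA₁ hA₂)) (comp (l2 B₁ B₂ hB₁ hB₂) f₂)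
  | m_nat {A B : Formula L} (hA : A.IFree) (hB : B.IFree) (f : STerm A B) :
      SEq (comp f (m A hA)) (comp (m B hB) (plus f f))
  | m_l1 (A : Formula L) (hA : A.IFree) : SEq (comp (m A hA) (l1 A A hA hA)) (one A hA)
  | m_l2 (A : Formula L) (hA : A.IFree) : SEq (comp (m A hA) (l2 A A hA hA)) (one A hA)
  | m_l (A B : Formula L) (hA : A.IFree) (hB : B.IFree) :
      SEq (comp (m (sum A B) ⟨hA, hB⟩) (plus (l1 A B hA hB) (l2 A B hA hB)))
        (one (sum A B) ⟨hA, hB⟩)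
  | l_uniq {A : Formula L} (hA : A.IFree) (f : STerm O A) : SEq f (l A hA)

end

section

open CategoryTheory

/-- Terms of type `A → B` modulo equality in the free dicartesian category. -/
def dSetoid {L : Type*} (A B : Formula L) : Setoid (DTerm A B) where
  r := DEq
  iseqv := ⟨DEq.refl, DEq.symm, DEq.trans⟩

/-- Terms of type `A → B` modulo equality in the free sesquicartesian category. -/
def sSetoid {L : Type*} (A B : Formula L) : Setoid (STerm A B) where
  r := SEq
  iseqv := ⟨SEq.refl, SEq.symm, SEq.trans⟩

/-- The objects of the free dicartesian category generated by `L`: all formulae. -/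
def FreeDicartesian (L : Type*) : Type _ := Formula L

/-- The objects of the free sesquicartesian category generated by `L`: the formulae in which
`I` does not occur. -/
def FreeSesquicartesian (L : Type*) : Type _ := {A : Formula L // A.IFree}

/-- The free dicartesian category generated by `L`. -/
instance FreeDicartesian.category (L : Type*) : Category (FreeDicartesian L) where
  Hom A B := Quotient (dSetoid (L := L) A B)
  id A := Quotient.mk (dSetoid (L := L) A A) (DTerm.one A)
  comp {A B C} f g := Quotient.map₂ (sa := dSetoid (L := L) A B) (sb := dSetoid (L := L) B C)
    (sc := dSetoid (L := L) A C) (fun f g => DTerm.comp g f)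
    (fun _ _ hf _ _ hg => DEq.comp_congr hg hf) f g
  id_comp f := Quotient.inductionOn f fun f => Quotient.sound (DEq.comp_one f)
  comp_id f := Quotient.inductionOn f fun f => Quotient.sound (DEq.one_comp f)
  assoc f g h := Quotient.inductionOn₃ f g h fun f g h => Quotient.sound (DEq.assoc h g f)

/-- The free sesquicartesian category generated by `L`. -/
instance FreeSesquicartesian.category (L : Type*) : Category (FreeSesquicartesian L) where
  Hom A B := Quotient (sSetoid A.1 B.1)
  id A := Quotient.mk (sSetoid A.1 A.1) (STerm.one A.1 A.2)
  comp {A B C} f g := Quotient.map₂ (sa := sSetoid A.1 B.1) (sb := sSetoid B.1 C.1)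
    (sc := sSetoid A.1 C.1) (fun f g => STerm.comp g f)
    (fun _ _ hf _ _ hg => SEq.comp_congr hg hf) f g
  id_comp {A _} f := Quotient.inductionOn f fun f => Quotient.sound (SEq.comp_one A.2 f)
  comp_id {_ B} f := Quotient.inductionOn f fun f => Quotient.sound (SEq.one_comp B.2 f)
  assoc f g h := Quotient.inductionOn₃ f g h fun f g h => Quotient.sound (SEq.assoc h g f)

/-- A term of the free sesquicartesian category, read as a term of the free dicartesian
category. -/
def STerm.toDTerm {L : Type*} : {A B : Formula L} → STerm A B → DTerm A B
  | _, _, .one A _ => .one A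
  | _, _, .l A _ => .l A
  | _, _, .k1 A B _ _ => .k1 A B
  | _, _, .k2 A B _ _ => .k2 A B
  | _, _, .l1 A B _ _ => .l1 A B
  | _, _, .l2 A B _ _ => .l2 A B
  | _, _, .w A _ => .w A
  | _, _, .m A _ => .m A
  | _, _, .comp g f => .comp g.toDTerm f.toDTerm
  | _, _, .times f g => .times f.toDTerm g.toDTerm
  | _, _, .plus f g => .plus f.toDTerm g.toDTerm

theorem SEq.toDEq {L : Type*} {A B : Formula L} {f g : STerm A B} (h : SEq f g) :
    DEq f.toDTerm g.toDTerm := by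
  induction h with
  | refl f => exact .refl _
  | symm _ ih => exact ih.symm
  | trans _ _ ih₁ ih₂ => exact ih₁.trans ih₂
  | comp_congr _ _ ih₁ ih₂ => exact .comp_congr ih₁ ih₂
  | times_congr _ _ ih₁ ih₂ => exact .times_congr ih₁ ih₂
  | plus_congr _ _ ih₁ ih₂ => exact .plus_congr ih₁ ih₂
  | one_comp => exact .one_comp _
  | comp_one => exact .comp_one _
  | assoc => exact .assoc _ _ _
  | times_one => exact .times_one _ _
  | times_comp => exact .times_comp _ _ _ _
  | k1_nat => exact .k1_nat _ _
  | k2_nat => exact .k2_nat _ _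
  | w_nat => exact .w_nat _
  | k1_w => exact .k1_w _
  | k2_w => exact .k2_w _
  | k_w => exact .k_w _ _
  | kO => exact .kO
  | plus_one => exact .plus_one _ _
  | plus_comp => exact .plus_comp _ _ _ _
  | l1_nat => exact .l1_nat _ _
  | l2_nat => exact .l2_nat _ _
  | m_nat => exact .m_nat _
  | m_l1 => exact .m_l1 _
  | m_l2 => exact .m_l2 _
  | m_l => exact .m_l _ _
  | l_uniq => exact .l_uniq _

/-- The canonical functor from the free sesquicartesian category to the free dicartesian
category: it sends a formula to itself and the class of a term to the class of that term. -/
def FreeSesquicartesian.inclusion (L : Type*) : FreeSesquicartesian L ⥤ FreeDicartesian L where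
  obj A := A.1
  map {A B} f := Quotient.map (sa := sSetoid A.1 B.1) (sb := dSetoid A.1 B.1)
    STerm.toDTerm (fun _ _ h => SEq.toDEq h) f
  map_id _ := rfl
  map_comp f g := Quotient.inductionOn₂ f g fun _ _ => rfl

end

section

open Formula

variable {L : Type*}

/-! Adjoin to the free sesquicartesian category $\mathcal S$ a new terminal object $\top$ (`none`)
with no arrow from $\top$ to an old object. The result $\mathcal S^\top$ is dicartesian, with
$A\times\top=A$ and $A+\top=\top$. The sum is harmless because a map out of $A+\top$ restricts to a
map out of $\top$, so its target is $\top$. The equation $l^1_{\mathrm I,\mathrm I}=l^2_{\mathrm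
I,\mathrm I}$ holds because its target is $\top$.

Reading $\mathrm I$ as $\top$ therefore gives a functor $F:\mathcal D\to\mathcal S^\top$
(`DEq.toTop`). It is the identity on terms of $\mathcal S$ (`STerm.toDTerm_toTop`), so an equality
in $\mathcal D$ between such terms already holds in $\mathcal S$: this is faithfulness.

For fullness, let $J:\mathcal S^\top\to\mathcal D$ read $\top$ back as $\mathrm I$. There are arrows
$A\to JFA$, natural in $A$ (`DTerm.comparison_naturality`); they need not be invertible, but they
equal identities when $\mathrm I$ does not occur in $A$ (`Formula.comparison_of_iFree`). For $f$
between such formulae, naturality reads $f=JFf$, and $Ff$ is a term of $\mathcal S$. No normal form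
for terms is needed. -/

theorem STerm.iFree_source_target {A B : Formula L} (f : STerm A B) : A.IFree ∧ B.IFree := by
  induction f with
  | one A hA => exact ⟨hA, hA⟩
  | l A hA => exact ⟨trivial, hA⟩
  | k1 A B hA hB => exact ⟨⟨hA, hB⟩, hA⟩
  | k2 A B hA hB => exact ⟨⟨hA, hB⟩, hB⟩
  | l1 A B hA hB => exact ⟨hA, hA, hB⟩
  | l2 A B hA hB => exact ⟨hB, hA, hB⟩
  | w A hA => exact ⟨hA, hA, hA⟩
  | m A hA => exact ⟨⟨hA, hA⟩, hA⟩
  | comp g f ihg ihf => exact ⟨ihf.1, ihg.2⟩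
  | times f g ihf ihg => exact ⟨⟨ihf.1, ihg.1⟩, ihf.2, ihg.2⟩
  | plus f g ihf ihg => exact ⟨⟨ihf.1, ihg.1⟩, ihf.2, ihg.2⟩

/-! ### Adjoining a terminal object to the free sesquicartesian category

The free sesquicartesian category with a new terminal object `none` such that there are no arrows
from `none` to the old objects is dicartesian, with `A × none = A` and `A + none = none`. -/

/-- Formulae without `I`, together with a new object `none`. -/
abbrev TopObj (L : Type*) : Type _ := Option {A : Formula L // A.IFree}

/-- Arrow terms between the objects of `TopObj L`, where `none` is terminal. -/
def TopTerm : TopObj L → TopObj L → Type _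
  | some A, some B => STerm A.1 B.1
  | _, none => PUnit
  | none, some _ => PEmpty

/-- Equality of arrow terms between the objects of `TopObj L`. -/
def TopEq : {a b : TopObj L} → TopTerm a b → TopTerm a b → Prop
  | some _, some _, f, g => SEq (show STerm _ _ from f) g
  | none, none, _, _ => True
  | some _, none, _, _ => True
  | none, some _, _, _ => True

namespace TopObj

/-- The product, for which `none` is neutral. -/
def prod : TopObj L → TopObj L → TopObj L
  | some A, some B => some ⟨.prod A.1 B.1, A.2, B.2⟩
  | some A, none => some A
  | none, some B => some B
  | none, none => none

/-- The sum, for which `none` is absorbing. -/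
def sum : TopObj L → TopObj L → TopObj L
  | some A, some B => some ⟨.sum A.1 B.1, A.2, B.2⟩
  | some _, none => none
  | none, some _ => none
  | none, none => none

/-- The formula named by an object, with `none` read as `I`. -/
def toFormula : TopObj L → Formula L
  | some A => A.1
  | none => I

end TopObj

/-! ### Structural arrows and operations with the terminal object adjoined. -/

namespace TopTerm

def one : (a : TopObj L) → TopTerm a a
  | some A => STerm.one A.1 A.2
  | none => ⟨⟩

def k : (a : TopObj L) → TopTerm a none
  | some _ => ⟨⟩
  | none => ⟨⟩

def l : (a : TopObj L) → TopTerm (some ⟨O, trivial⟩) a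
  | some A => STerm.l A.1 A.2
  | none => ⟨⟩

def k1 : (a b : TopObj L) → TopTerm (a.prod b) a
  | some A, some B => STerm.k1 A.1 B.1 A.2 B.2
  | some A, none => STerm.one A.1 A.2
  | none, some _ => ⟨⟩
  | none, none => ⟨⟩

def k2 : (a b : TopObj L) → TopTerm (a.prod b) b
  | some A, some B => STerm.k2 A.1 B.1 A.2 B.2
  | some _, none => ⟨⟩
  | none, some B => STerm.one B.1 B.2
  | none, none => ⟨⟩

def l1 : (a b : TopObj L) → TopTerm a (a.sum b)
  | some A, some B => STerm.l1 A.1 B.1 A.2 B.2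
  | some _, none => ⟨⟩
  | none, some _ => ⟨⟩
  | none, none => ⟨⟩

def l2 : (a b : TopObj L) → TopTerm b (a.sum b)
  | some A, some B => STerm.l2 A.1 B.1 A.2 B.2
  | some _, none => ⟨⟩
  | none, some _ => ⟨⟩
  | none, none => ⟨⟩

def w : (a : TopObj L) → TopTerm a (a.prod a)
  | some A => STerm.w A.1 A.2
  | none => ⟨⟩

def m : (a : TopObj L) → TopTerm (a.sum a) a
  | some A => STerm.m A.1 A.2
  | none => ⟨⟩

def comp : {a b c : TopObj L} → TopTerm b c → TopTerm a b → TopTerm a c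
  | some _, some _, some _, g, f => STerm.comp (show STerm _ _ from g) (show STerm _ _ from f)
  | some _, _, none, _, _ => ⟨⟩
  | none, _, none, _, _ => ⟨⟩
  | _, none, some _, g, _ => PEmpty.elim g
  | none, some _, some _, _, f => PEmpty.elim f

/-- When one target is `none`, that factor disappears from the product of the targets but may
survive in the product of the sources; a projection then discards it. -/
def times : {a b c d : TopObj L} → TopTerm a b → TopTerm c d → TopTerm (a.prod c) (b.prod d)
  | some _, some _, some _, some _, f, g =>
      STerm.times (show STerm _ _ from f) (show STerm _ _ from g)
  | some A, some _, some C, none, f, _ =>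
      STerm.comp (show STerm _ _ from f) (STerm.k1 A.1 C.1 A.2 C.2)
  | some _, some _, none, none, f, _ => f
  | some A, none, some C, some _, _, g =>
      STerm.comp (show STerm _ _ from g) (STerm.k2 A.1 C.1 A.2 C.2)
  | none, none, some _, some _, _, g => g
  | some _, none, some _, none, _, _ => ⟨⟩
  | some _, none, none, none, _, _ => ⟨⟩
  | none, none, some _, none, _, _ => ⟨⟩
  | none, none, none, none, _, _ => ⟨⟩
  | none, some _, _, _, f, _ => PEmpty.elim f
  | _, _, none, some _, _, g => PEmpty.elim g

/-- A single target `none` makes the whole target sum `none`, so only the unique arrow is left. -/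
def plus : {a b c d : TopObj L} → TopTerm a b → TopTerm c d → TopTerm (a.sum c) (b.sum d)
  | some _, some _, some _, some _, f, g =>
      STerm.plus (show STerm _ _ from f) (show STerm _ _ from g)
  | a, some _, c, none, _, _ => k (a.sum c)
  | a, none, c, some _, _, _ => k (a.sum c)
  | a, none, c, none, _, _ => k (a.sum c)
  | none, some _, _, _, f, _ => PEmpty.elim f
  | _, _, none, some _, _, g => PEmpty.elim g

/-- The arrow term of the free dicartesian category named by an arrow term over `TopObj L`. -/
def toDTerm : {a b : TopObj L} → TopTerm a b → DTerm a.toFormula b.toFormula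
  | some _, some _, f => STerm.toDTerm f
  | some A, none, _ => DTerm.k A.1
  | none, none, _ => DTerm.k I
  | none, some _, f => PEmpty.elim f

end TopTerm

/-! ### The dicartesian equations with the terminal object adjoined. -/

namespace TopEq

/-- Terminality of `none`. With the absence of arrows from `none` to old objects, it disposes of
most case splits below; what remains is an equation of $\mathcal S$. -/
theorem to_none {a : TopObj L} (f g : TopTerm a none) : TopEq f g := by
  cases a <;> trivial

theorem refl {a b : TopObj L} (f : TopTerm a b) : TopEq f f := by
  rcases a with _ | A <;> rcases b with _ | B <;> first | trivial | exact SEq.refl _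

theorem symm {a b : TopObj L} {f g : TopTerm a b} (h : TopEq f g) : TopEq g f := by
  rcases a with _ | A <;> rcases b with _ | B <;> first | trivial | exact SEq.symm h

theorem trans {a b : TopObj L} {f g h : TopTerm a b} (h₁ : TopEq f g) (h₂ : TopEq g h) :
    TopEq f h := by
  rcases a with _ | A <;> rcases b with _ | B <;> first | trivial | exact SEq.trans h₁ h₂

theorem comp_congr {a b c : TopObj L} {g g' : TopTerm b c} {f f' : TopTerm a b}
    (hg : TopEq g g') (hf : TopEq f f') : TopEq (g.comp f) (g'.comp f') := by
  rcases c with _ | C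
  · exact to_none _ _
  rcases b with _ | B
  · exact PEmpty.elim g
  rcases a with _ | A
  · exact PEmpty.elim f
  exact SEq.comp_congr hg hf

theorem times_congr {a b c d : TopObj L} {f f' : TopTerm a b} {g g' : TopTerm c d}
    (hf : TopEq f f') (hg : TopEq g g') : TopEq (f.times g) (f'.times g') := by
  rcases b with _ | B <;> rcases d with _ | D <;> rcases a with _ | A <;> rcases c with _ | C <;>
    first
    | exact PEmpty.elim f
    | exact PEmpty.elim g
    | exact to_none _ _
    | exact hf
    | exact hg
    | exact SEq.times_congr hf hg
    | exact SEq.comp_congr hf (SEq.refl _)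
    | exact SEq.comp_congr hg (SEq.refl _)

theorem plus_congr {a b c d : TopObj L} {f f' : TopTerm a b} {g g' : TopTerm c d}
    (hf : TopEq f f') (hg : TopEq g g') : TopEq (f.plus g) (f'.plus g') := by
  rcases b with _ | B <;> rcases d with _ | D <;> rcases a with _ | A <;> rcases c with _ | C <;>
    first
    | exact PEmpty.elim f
    | exact PEmpty.elim g
    | exact to_none _ _
    | exact SEq.plus_congr hf hg

theorem one_comp {a b : TopObj L} (f : TopTerm a b) : TopEq ((TopTerm.one b).comp f) f := by
  rcases b with _ | B <;> rcases a with _ | A <;>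
    first
    | exact PEmpty.elim f
    | exact to_none _ _
    | exact SEq.one_comp _ _

theorem comp_one {a b : TopObj L} (f : TopTerm a b) : TopEq (f.comp (TopTerm.one a)) f := by
  rcases b with _ | B <;> rcases a with _ | A <;>
    first
    | exact PEmpty.elim f
    | exact to_none _ _
    | exact SEq.comp_one _ _

theorem assoc {a b c d : TopObj L} (h : TopTerm c d) (g : TopTerm b c) (f : TopTerm a b) :
    TopEq (h.comp (g.comp f)) ((h.comp g).comp f) := by
  rcases d with _ | D
  · exact to_none _ _
  rcases c with _ | C
  · exact PEmpty.elim h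
  rcases b with _ | B
  · exact PEmpty.elim g
  rcases a with _ | A
  · exact PEmpty.elim f
  exact SEq.assoc _ _ _

theorem times_one (a b : TopObj L) :
    TopEq ((TopTerm.one a).times (TopTerm.one b)) (TopTerm.one (a.prod b)) := by
  rcases a with _ | A <;> rcases b with _ | B <;>
    first
    | exact to_none _ _
    | exact SEq.refl _
    | exact SEq.times_one _ _ _ _

/-- If exactly one final target is `none`, the point at which its factor is projected away depends
on the middle objects. Associativity suffices if the factor is already gone in the middle; otherwise
naturality of the projection moves it past the first arrow. -/
theorem times_comp {a b c a' b' c' : TopObj L} (g₁ : TopTerm b c) (g₂ : TopTerm a b)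
    (f₁ : TopTerm b' c') (f₂ : TopTerm a' b') :
    TopEq ((g₁.comp g₂).times (f₁.comp f₂)) ((g₁.times f₁).comp (g₂.times f₂)) := by
  rcases c with _ | C <;> rcases c' with _ | C'
  · exact to_none _ _
  all_goals
    rcases b with _ | B <;> rcases b' with _ | B' <;>
      first
      | exact PEmpty.elim g₁
      | exact PEmpty.elim f₁
      | rcases a with _ | A <;> rcases a' with _ | A' <;>
          first
          | exact PEmpty.elim g₂
          | exact PEmpty.elim f₂
          | exact SEq.refl _
          | exact SEq.times_comp _ _ _ _
          | exact SEq.symm (SEq.assoc _ _ _)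
          | exact ((SEq.assoc _ _ _).symm.trans
              (SEq.comp_congr (SEq.refl _) (SEq.k1_nat _ _ _ _ _ _).symm)).trans (SEq.assoc _ _ _)
          | exact ((SEq.assoc _ _ _).symm.trans
              (SEq.comp_congr (SEq.refl _) (SEq.k2_nat _ _ _ _ _ _).symm)).trans (SEq.assoc _ _ _)

theorem k1_nat {a₁ a₂ b₁ b₂ : TopObj L} (f₁ : TopTerm a₁ b₁) (f₂ : TopTerm a₂ b₂) :
    TopEq ((TopTerm.k1 b₁ b₂).comp (f₁.times f₂)) (f₁.comp (TopTerm.k1 a₁ a₂)) := by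
  rcases b₁ with _ | B₁
  · exact to_none _ _
  rcases a₁ with _ | A₁
  · exact PEmpty.elim f₁
  rcases b₂ with _ | B₂ <;> rcases a₂ with _ | A₂ <;>
    first
    | exact PEmpty.elim f₂
    | exact SEq.k1_nat _ _ _ _ _ _
    | exact SEq.one_comp _ _
    | exact (SEq.one_comp _ _).trans (SEq.comp_one _ _).symm

theorem k2_nat {a₁ a₂ b₁ b₂ : TopObj L} (f₁ : TopTerm a₁ b₁) (f₂ : TopTerm a₂ b₂) :
    TopEq ((TopTerm.k2 b₁ b₂).comp (f₁.times f₂)) (f₂.comp (TopTerm.k2 a₁ a₂)) := by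
  rcases b₂ with _ | B₂
  · exact to_none _ _
  rcases a₂ with _ | A₂
  · exact PEmpty.elim f₂
  rcases b₁ with _ | B₁ <;> rcases a₁ with _ | A₁ <;>
    first
    | exact PEmpty.elim f₁
    | exact SEq.k2_nat _ _ _ _ _ _
    | exact SEq.one_comp _ _
    | exact (SEq.one_comp _ _).trans (SEq.comp_one _ _).symm

theorem w_nat {a b : TopObj L} (f : TopTerm a b) :
    TopEq ((TopTerm.w b).comp f) ((f.times f).comp (TopTerm.w a)) := by
  rcases b with _ | B
  · exact to_none _ _
  rcases a with _ | A
  · exact PEmpty.elim f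
  exact SEq.w_nat _ _ _

theorem k1_w (a : TopObj L) : TopEq ((TopTerm.k1 a a).comp (TopTerm.w a)) (TopTerm.one a) := by
  rcases a with _ | A
  · exact to_none _ _
  exact SEq.k1_w _ _

theorem k2_w (a : TopObj L) : TopEq ((TopTerm.k2 a a).comp (TopTerm.w a)) (TopTerm.one a) := by
  rcases a with _ | A
  · exact to_none _ _
  exact SEq.k2_w _ _

/-- With exactly one factor `none`, the product of projections collapses to a single projection
after an identity, and the equation reduces to `SEq.k1_w` or `SEq.k2_w`. -/
theorem k_w (a b : TopObj L) :
    TopEq (((TopTerm.k1 a b).times (TopTerm.k2 a b)).comp (TopTerm.w (a.prod b)))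
      (TopTerm.one (a.prod b)) := by
  rcases a with _ | A <;> rcases b with _ | B
  · exact to_none _ _
  · exact (SEq.comp_congr (SEq.one_comp _ _) (SEq.refl _)).trans (SEq.k2_w _ _)
  · exact (SEq.comp_congr (SEq.one_comp _ _) (SEq.refl _)).trans (SEq.k1_w _ _)
  · exact SEq.k_w _ _ _ _

theorem plus_one (a b : TopObj L) :
    TopEq ((TopTerm.one a).plus (TopTerm.one b)) (TopTerm.one (a.sum b)) := by
  rcases a with _ | A <;> rcases b with _ | B <;>
    first
    | exact to_none _ _
    | exact SEq.plus_one _ _ _ _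

/-- Unlike for products there are no mixed cases: unless the target sum is `none`, both final
targets are old, which forces every object to be old. -/
theorem plus_comp {a b c a' b' c' : TopObj L} (g₁ : TopTerm b c) (g₂ : TopTerm a b)
    (f₁ : TopTerm b' c') (f₂ : TopTerm a' b') :
    TopEq ((g₁.comp g₂).plus (f₁.comp f₂)) ((g₁.plus f₁).comp (g₂.plus f₂)) := by
  rcases c with _ | C <;> rcases c' with _ | C' <;> try exact to_none _ _
  rcases b with _ | B
  · exact PEmpty.elim g₁
  rcases b' with _ | B'
  · exact PEmpty.elim f₁
  rcases a with _ | A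
  · exact PEmpty.elim g₂
  rcases a' with _ | A'
  · exact PEmpty.elim f₂
  exact SEq.plus_comp _ _ _ _

theorem l1_nat {a₁ a₂ b₁ b₂ : TopObj L} (f₁ : TopTerm a₁ b₁) (f₂ : TopTerm a₂ b₂) :
    TopEq ((f₁.plus f₂).comp (TopTerm.l1 a₁ a₂)) ((TopTerm.l1 b₁ b₂).comp f₁) := by
  rcases b₁ with _ | B₁ <;> rcases b₂ with _ | B₂ <;> try exact to_none _ _
  rcases a₁ with _ | A₁
  · exact PEmpty.elim f₁
  rcases a₂ with _ | A₂
  · exact PEmpty.elim f₂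
  exact SEq.l1_nat _ _ _ _ _ _

theorem l2_nat {a₁ a₂ b₁ b₂ : TopObj L} (f₁ : TopTerm a₁ b₁) (f₂ : TopTerm a₂ b₂) :
    TopEq ((f₁.plus f₂).comp (TopTerm.l2 a₁ a₂)) ((TopTerm.l2 b₁ b₂).comp f₂) := by
  rcases b₁ with _ | B₁ <;> rcases b₂ with _ | B₂ <;> try exact to_none _ _
  rcases a₁ with _ | A₁
  · exact PEmpty.elim f₁
  rcases a₂ with _ | A₂
  · exact PEmpty.elim f₂
  exact SEq.l2_nat _ _ _ _ _ _

theorem m_nat {a b : TopObj L} (f : TopTerm a b) :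
    TopEq (f.comp (TopTerm.m a)) ((TopTerm.m b).comp (f.plus f)) := by
  rcases b with _ | B
  · exact to_none _ _
  rcases a with _ | A
  · exact PEmpty.elim f
  exact SEq.m_nat _ _ _

theorem m_l1 (a : TopObj L) : TopEq ((TopTerm.m a).comp (TopTerm.l1 a a)) (TopTerm.one a) := by
  rcases a with _ | A
  · exact to_none _ _
  exact SEq.m_l1 _ _

theorem m_l2 (a : TopObj L) : TopEq ((TopTerm.m a).comp (TopTerm.l2 a a)) (TopTerm.one a) := by
  rcases a with _ | A
  · exact to_none _ _
  exact SEq.m_l2 _ _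

theorem m_l (a b : TopObj L) :
    TopEq ((TopTerm.m (a.sum b)).comp ((TopTerm.l1 a b).plus (TopTerm.l2 a b)))
      (TopTerm.one (a.sum b)) := by
  rcases a with _ | A <;> rcases b with _ | B <;> try exact to_none _ _
  exact SEq.m_l _ _ _ _

theorem l_uniq {a : TopObj L} (f : TopTerm (some ⟨O, trivial⟩) a) : TopEq f (TopTerm.l a) := by
  rcases a with _ | A
  · exact to_none _ _
  exact SEq.l_uniq _ _

end TopEq

/-! ### Interpretation of the free dicartesian category -/

/-- The interpretation of formulae, with `I` interpreted by the terminal object. -/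
def Formula.toTop : Formula L → TopObj L
  | letter p => some ⟨letter p, trivial⟩
  | I => none
  | O => some ⟨O, trivial⟩
  | prod A B => A.toTop.prod B.toTop
  | sum A B => A.toTop.sum B.toTop

/-- The interpretation of the arrow terms of the free dicartesian category. -/
def DTerm.toTop : {A B : Formula L} → DTerm A B → TopTerm A.toTop B.toTop
  | _, _, .one A => TopTerm.one A.toTop
  | _, _, .k A => TopTerm.k A.toTop
  | _, _, .l A => TopTerm.l A.toTop
  | _, _, .k1 A B => TopTerm.k1 A.toTop B.toTop
  | _, _, .k2 A B => TopTerm.k2 A.toTop B.toTop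
  | _, _, .l1 A B => TopTerm.l1 A.toTop B.toTop
  | _, _, .l2 A B => TopTerm.l2 A.toTop B.toTop
  | _, _, .w A => TopTerm.w A.toTop
  | _, _, .m A => TopTerm.m A.toTop
  | _, _, .comp g f => g.toTop.comp f.toTop
  | _, _, .times f g => f.toTop.times g.toTop
  | _, _, .plus f g => f.toTop.plus g.toTop

theorem DEq.toTop {A B : Formula L} {f g : DTerm A B} (h : DEq f g) :
    TopEq f.toTop g.toTop := by
  induction h with
  | refl f => exact .refl _
  | symm _ ih => exact ih.symm
  | trans _ _ ih₁ ih₂ => exact ih₁.trans ih₂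
  | comp_congr _ _ ih₁ ih₂ => exact .comp_congr ih₁ ih₂
  | times_congr _ _ ih₁ ih₂ => exact .times_congr ih₁ ih₂
  | plus_congr _ _ ih₁ ih₂ => exact .plus_congr ih₁ ih₂
  | one_comp => exact .one_comp _
  | comp_one => exact .comp_one _
  | assoc => exact .assoc _ _ _
  | times_one => exact .times_one _ _
  | times_comp => exact .times_comp _ _ _ _
  | k1_nat => exact .k1_nat _ _
  | k2_nat => exact .k2_nat _ _
  | w_nat => exact .w_nat _
  | k1_w => exact .k1_w _
  | k2_w => exact .k2_w _
  | k_w => exact .k_w _ _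
  | k_uniq => exact .to_none _ _
  | kO => exact SEq.kO
  | plus_one => exact .plus_one _ _
  | plus_comp => exact .plus_comp _ _ _ _
  | l1_nat => exact .l1_nat _ _
  | l2_nat => exact .l2_nat _ _
  | m_nat => exact .m_nat _
  | m_l1 => exact .m_l1 _
  | m_l2 => exact .m_l2 _
  | m_l => exact .m_l _ _
  | l_uniq => exact .l_uniq _
  -- The target $\mathrm I+\mathrm I$ is interpreted by `none`.
  | lI => exact .to_none _ _

/-! ### The interpretation on formulae without `I`, and faithfulness. -/

theorem Formula.toTop_of_iFree {A : Formula L} (hA : A.IFree) : A.toTop = some ⟨A, hA⟩ := by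
  induction A with
  | letter p => rfl
  | I => exact hA.elim
  | O => rfl
  | prod A B ihA ihB => simp only [toTop, ihA hA.1, ihB hA.2, TopObj.prod]
  | sum A B ihA ihB => simp only [toTop, ihA hA.1, ihB hA.2, TopObj.sum]

/-- An arrow term of the free sesquicartesian category as an arrow term over `TopObj L`. -/
def STerm.toTop {A B : Formula L} (hA : A.IFree) (hB : B.IFree) (f : STerm A B) :
    TopTerm (some ⟨A, hA⟩ : TopObj L) (some ⟨B, hB⟩) := f

namespace TopTerm

/-- `A.toTop` equals `some ⟨A, hA⟩` only propositionally, hence the heterogeneous equalities; with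
variable objects the equations can be eliminated by substitution. -/
theorem comp_heq {a a' b b' c c' : TopObj L} (ha : a = a') (hb : b = b') (hc : c = c')
    {g : TopTerm b c} {g' : TopTerm b' c'} {f : TopTerm a b} {f' : TopTerm a' b'}
    (hg : HEq g g') (hf : HEq f f') : HEq (g.comp f) (g'.comp f') := by
  subst ha hb hc hg hf
  rfl

theorem times_heq {a a' b b' c c' d d' : TopObj L} (ha : a = a') (hb : b = b') (hc : c = c')
    (hd : d = d') {f : TopTerm a b} {f' : TopTerm a' b'} {g : TopTerm c d} {g' : TopTerm c' d'}
    (hf : HEq f f') (hg : HEq g g') : HEq (f.times g) (f'.times g') := by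
  subst ha hb hc hd hf hg
  rfl

theorem plus_heq {a a' b b' c c' d d' : TopObj L} (ha : a = a') (hb : b = b') (hc : c = c')
    (hd : d = d') {f : TopTerm a b} {f' : TopTerm a' b'} {g : TopTerm c d} {g' : TopTerm c' d'}
    (hf : HEq f f') (hg : HEq g g') : HEq (f.plus g) (f'.plus g') := by
  subst ha hb hc hd hf hg
  rfl

end TopTerm

/-- On old objects every clause of the interpretation returns the same term former, so the term
comes back literally and not just up to `SEq`. -/
theorem STerm.toDTerm_toTop {A B : Formula L} (f : STerm A B) (hA : A.IFree) (hB : B.IFree) :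
    HEq f.toDTerm.toTop (f.toTop hA hB) := by
  induction f with
  | one A =>
    change HEq (TopTerm.one A.toTop) (TopTerm.one (some ⟨A, hA⟩))
    rw [toTop_of_iFree hA]
  | l A =>
    change HEq (TopTerm.l A.toTop) (TopTerm.l (some ⟨A, hB⟩))
    rw [toTop_of_iFree hB]
  | k1 A B =>
    change HEq (TopTerm.k1 A.toTop B.toTop) (TopTerm.k1 (some ⟨A, hA.1⟩) (some ⟨B, hA.2⟩))
    rw [toTop_of_iFree hA.1, toTop_of_iFree hA.2]
  | k2 A B =>
    change HEq (TopTerm.k2 A.toTop B.toTop) (TopTerm.k2 (some ⟨A, hA.1⟩) (some ⟨B, hA.2⟩))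
    rw [toTop_of_iFree hA.1, toTop_of_iFree hA.2]
  | l1 A B =>
    change HEq (TopTerm.l1 A.toTop B.toTop) (TopTerm.l1 (some ⟨A, hB.1⟩) (some ⟨B, hB.2⟩))
    rw [toTop_of_iFree hB.1, toTop_of_iFree hB.2]
  | l2 A B =>
    change HEq (TopTerm.l2 A.toTop B.toTop) (TopTerm.l2 (some ⟨A, hB.1⟩) (some ⟨B, hB.2⟩))
    rw [toTop_of_iFree hB.1, toTop_of_iFree hB.2]
  | w A =>
    change HEq (TopTerm.w A.toTop) (TopTerm.w (some ⟨A, hA⟩))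
    rw [toTop_of_iFree hA]
  | m A =>
    change HEq (TopTerm.m A.toTop) (TopTerm.m (some ⟨A, hB⟩))
    rw [toTop_of_iFree hB]
  | comp g f ihg ihf =>
    have h := f.iFree_source_target.2
    exact TopTerm.comp_heq (toTop_of_iFree hA) (toTop_of_iFree h) (toTop_of_iFree hB)
      (ihg h hB) (ihf hA h)
  | times f g ihf ihg =>
    exact TopTerm.times_heq (toTop_of_iFree hA.1) (toTop_of_iFree hB.1) (toTop_of_iFree hA.2)
      (toTop_of_iFree hB.2) (ihf hA.1 hB.1) (ihg hA.2 hB.2)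
  | plus f g ihf ihg =>
    exact TopTerm.plus_heq (toTop_of_iFree hA.1) (toTop_of_iFree hB.1) (toTop_of_iFree hA.2)
      (toTop_of_iFree hB.2) (ihf hA.1 hB.1) (ihg hA.2 hB.2)

theorem TopEq.of_heq {a a' b b' : TopObj L} (ha : a = a') (hb : b = b')
    {f g : TopTerm a b} {f' g' : TopTerm a' b'} (hf : HEq f f') (hg : HEq g g')
    (h : TopEq f g) : TopEq f' g' := by
  subst ha hb hf hg
  exact h

/-- Arrow terms of the free sesquicartesian category that are equal in the free dicartesian
category are equal in the free sesquicartesian category. -/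
theorem SEq.of_toDTerm {A B : Formula L} {f g : STerm A B} (h : DEq f.toDTerm g.toDTerm) :
    SEq f g := by
  obtain ⟨hA, hB⟩ := f.iFree_source_target
  -- Between old objects, `TopEq` is `SEq` by definition.
  exact TopEq.of_heq (toTop_of_iFree hA) (toTop_of_iFree hB) (f.toDTerm_toTop hA hB)
    (g.toDTerm_toTop hA hB) h.toTop

/-! ### Comparison of a formula with its interpretation -/

namespace TopObj

/-- The comparison of the product of formulae with the product of objects. -/
def prodComparison : (a b : TopObj L) →
    DTerm (.prod a.toFormula b.toFormula) (a.prod b).toFormula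
  | some A, some B => DTerm.one (.prod A.1 B.1)
  | some A, none => DTerm.k1 A.1 I
  | none, some B => DTerm.k2 I B.1
  | none, none => DTerm.k (.prod I I)

/-- The comparison of the sum of formulae with the sum of objects. -/
def sumComparison : (a b : TopObj L) →
    DTerm (.sum a.toFormula b.toFormula) (a.sum b).toFormula
  | some A, some B => DTerm.one (.sum A.1 B.1)
  | some A, none => DTerm.k (.sum A.1 I)
  | none, some B => DTerm.k (.sum I B.1)
  | none, none => DTerm.k (.sum I I)

end TopObj

/-- The comparison of a formula with its interpretation. -/
def Formula.comparison : (A : Formula L) → DTerm A A.toTop.toFormula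
  | letter p => DTerm.one (letter p)
  | I => DTerm.one I
  | O => DTerm.one O
  | prod A B => (A.toTop.prodComparison B.toTop).comp (A.comparison.times B.comparison)
  | sum A B => (A.toTop.sumComparison B.toTop).comp (A.comparison.plus B.comparison)

/-! ### Equational calculus of squares in the free dicartesian category. -/

namespace DEq

theorem to_I {A : Formula L} (f g : DTerm A I) : DEq f g :=
  (k_uniq f).trans (k_uniq g).symm

theorem comp_left {A B C : Formula L} (g : DTerm B C) {f f' : DTerm A B} (h : DEq f f') :
    DEq (g.comp f) (g.comp f') :=
  comp_congr (refl g) h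

theorem comp_right {A B C : Formula L} {g g' : DTerm B C} (h : DEq g g') (f : DTerm A B) :
    DEq (g.comp f) (g'.comp f) :=
  comp_congr h (refl f)

/-- Pasting of commutative squares. -/
theorem paste {A A' B B' C C' : Formula L} {a : DTerm A A'} {b : DTerm B B'} {c : DTerm C C'}
    {f : DTerm A B} {f' : DTerm A' B'} {g : DTerm B C} {g' : DTerm B' C'}
    (hg : DEq (c.comp g) (g'.comp b)) (hf : DEq (b.comp f) (f'.comp a)) :
    DEq (c.comp (g.comp f)) ((g'.comp f').comp a) :=
  (assoc _ _ _).trans <| (comp_right hg f).trans <| (assoc _ _ _).symm.trans <|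
    (comp_left g' hf).trans (assoc _ _ _)

theorem times_square {A A' B B' C C' D D' : Formula L} {a : DTerm A A'} {b : DTerm B B'}
    {c : DTerm C C'} {d : DTerm D D'} {f : DTerm A B} {f' : DTerm A' B'} {g : DTerm C D}
    {g' : DTerm C' D'} (hf : DEq (b.comp f) (f'.comp a)) (hg : DEq (d.comp g) (g'.comp c)) :
    DEq ((b.times d).comp (f.times g)) ((f'.times g').comp (a.times c)) :=
  (times_comp _ _ _ _).symm.trans <| (times_congr hf hg).trans (times_comp _ _ _ _)

theorem plus_square {A A' B B' C C' D D' : Formula L} {a : DTerm A A'} {b : DTerm B B'}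
    {c : DTerm C C'} {d : DTerm D D'} {f : DTerm A B} {f' : DTerm A' B'} {g : DTerm C D}
    {g' : DTerm C' D'} (hf : DEq (b.comp f) (f'.comp a)) (hg : DEq (d.comp g) (g'.comp c)) :
    DEq ((b.plus d).comp (f.plus g)) ((f'.plus g').comp (a.plus c)) :=
  (plus_comp _ _ _ _).symm.trans <| (plus_congr hf hg).trans (plus_comp _ _ _ _)

theorem one_comp_comp_one {A B : Formula L} (f : DTerm A B) :
    DEq ((DTerm.one B).comp f) (f.comp (DTerm.one A)) :=
  (one_comp f).trans (comp_one f).symm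

end DEq

/-! ### Compatibility of the comparisons with the structural arrows. -/

namespace TopTerm

theorem toDTerm_one (a : TopObj L) : DEq (one a).toDTerm (DTerm.one a.toFormula) := by
  rcases a with _ | A
  · exact .to_I _ _
  · exact .refl _

theorem toDTerm_comp {a b c : TopObj L} (g : TopTerm b c) (f : TopTerm a b) :
    DEq (g.comp f).toDTerm (g.toDTerm.comp f.toDTerm) := by
  rcases c with _ | C
  · exact .to_I _ _
  rcases b with _ | B
  · exact PEmpty.elim g
  rcases a with _ | A
  · exact PEmpty.elim f
  exact .refl _

theorem toDTerm_k1 (a b : TopObj L) :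
    DEq (DTerm.k1 a.toFormula b.toFormula) ((k1 a b).toDTerm.comp (a.prodComparison b)) := by
  rcases a with _ | A
  · exact .to_I _ _
  rcases b with _ | B
  · exact (DEq.one_comp _).symm
  · exact (DEq.comp_one _).symm

theorem toDTerm_k2 (a b : TopObj L) :
    DEq (DTerm.k2 a.toFormula b.toFormula) ((k2 a b).toDTerm.comp (a.prodComparison b)) := by
  rcases b with _ | B
  · exact .to_I _ _
  rcases a with _ | A
  · exact (DEq.one_comp _).symm
  · exact (DEq.comp_one _).symm

theorem toDTerm_w (a : TopObj L) :
    DEq ((a.prodComparison a).comp (DTerm.w a.toFormula)) (w a).toDTerm := by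
  rcases a with _ | A
  · exact .to_I _ _
  · exact .one_comp _

theorem toDTerm_l1 (a b : TopObj L) :
    DEq ((a.sumComparison b).comp (DTerm.l1 a.toFormula b.toFormula)) (l1 a b).toDTerm := by
  rcases a with _ | A <;> rcases b with _ | B <;> try exact .to_I _ _
  exact .one_comp _

theorem toDTerm_l2 (a b : TopObj L) :
    DEq ((a.sumComparison b).comp (DTerm.l2 a.toFormula b.toFormula)) (l2 a b).toDTerm := by
  rcases a with _ | A <;> rcases b with _ | B <;> try exact .to_I _ _
  exact .one_comp _

theorem toDTerm_m (a : TopObj L) :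
    DEq (DTerm.m a.toFormula) ((m a).toDTerm.comp (a.sumComparison a)) := by
  rcases a with _ | A
  · exact .to_I _ _
  · exact (DEq.comp_one _).symm

/-- If exactly one target is `none`, the comparison at the target is a projection and the square is
its naturality. -/
theorem toDTerm_times {a b c d : TopObj L} (f : TopTerm a b) (g : TopTerm c d) :
    DEq ((b.prodComparison d).comp (f.toDTerm.times g.toDTerm))
      ((f.times g).toDTerm.comp (a.prodComparison c)) := by
  rcases b with _ | B <;> rcases d with _ | D <;> rcases a with _ | A <;> rcases c with _ | C <;>
    first
    | exact PEmpty.elim f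
    | exact PEmpty.elim g
    | exact DEq.to_I _ _
    | exact DEq.one_comp_comp_one _
    | exact DEq.k1_nat _ _
    | exact DEq.k2_nat _ _
    | exact (DEq.k1_nat _ _).trans (DEq.comp_one _).symm
    | exact (DEq.k2_nat _ _).trans (DEq.comp_one _).symm

theorem toDTerm_plus {a b c d : TopObj L} (f : TopTerm a b) (g : TopTerm c d) :
    DEq ((b.sumComparison d).comp (f.toDTerm.plus g.toDTerm))
      ((f.plus g).toDTerm.comp (a.sumComparison c)) := by
  rcases b with _ | B <;> rcases d with _ | D <;> try exact .to_I _ _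
  rcases a with _ | A
  · exact PEmpty.elim f
  rcases c with _ | C
  · exact PEmpty.elim g
  exact DEq.one_comp_comp_one _

end TopTerm

/-- The comparison of formulae with their interpretations is natural. -/
theorem DTerm.comparison_naturality {A B : Formula L} (f : DTerm A B) :
    DEq (B.comparison.comp f) (f.toTop.toDTerm.comp A.comparison) := by
  induction f with
  | one A =>
    exact (DEq.one_comp_comp_one _).symm.trans (DEq.comp_right (TopTerm.toDTerm_one _).symm _)
  | k A => exact .to_I _ _
  | l A => exact (DEq.l_uniq _).trans (DEq.l_uniq _).symm
  | k1 A B =>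
    exact (DEq.k1_nat _ _).symm.trans <| (DEq.comp_right (TopTerm.toDTerm_k1 _ _) _).trans
      (DEq.assoc _ _ _).symm
  | k2 A B =>
    exact (DEq.k2_nat _ _).symm.trans <| (DEq.comp_right (TopTerm.toDTerm_k2 _ _) _).trans
      (DEq.assoc _ _ _).symm
  | l1 A B =>
    exact (DEq.assoc _ _ _).symm.trans <| (DEq.comp_left _ (DEq.l1_nat _ _)).trans <|
      (DEq.assoc _ _ _).trans (DEq.comp_right (TopTerm.toDTerm_l1 _ _) _)
  | l2 A B =>
    exact (DEq.assoc _ _ _).symm.trans <| (DEq.comp_left _ (DEq.l2_nat _ _)).trans <|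
      (DEq.assoc _ _ _).trans (DEq.comp_right (TopTerm.toDTerm_l2 _ _) _)
  | w A =>
    exact (DEq.assoc _ _ _).symm.trans <| (DEq.comp_left _ (DEq.w_nat _).symm).trans <|
      (DEq.assoc _ _ _).trans (DEq.comp_right (TopTerm.toDTerm_w _) _)
  | m A =>
    exact (DEq.m_nat _).trans <| (DEq.comp_right (TopTerm.toDTerm_m _) _).trans
      (DEq.assoc _ _ _).symm
  | comp g f ihg ihf =>
    exact (DEq.paste ihg ihf).trans (DEq.comp_right (TopTerm.toDTerm_comp _ _).symm _)
  | times f g ihf ihg =>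
    exact (DEq.assoc _ _ _).symm.trans <| (DEq.comp_left _ (DEq.times_square ihf ihg)).trans <|
      (DEq.assoc _ _ _).trans <| (DEq.comp_right (TopTerm.toDTerm_times _ _) _).trans
        (DEq.assoc _ _ _).symm
  | plus f g ihf ihg =>
    exact (DEq.assoc _ _ _).symm.trans <| (DEq.comp_left _ (DEq.plus_square ihf ihg)).trans <|
      (DEq.assoc _ _ _).trans <| (DEq.comp_right (TopTerm.toDTerm_plus _ _) _).trans
        (DEq.assoc _ _ _).symm

/-! ### The comparison on formulae without `I`, and fullness. -/

theorem prodComparison_comp_heq {A B : Formula L} {a a' b b' : TopObj L} (ha : a = a')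
    (hb : b = b') {s : DTerm A a.toFormula} {s' : DTerm A a'.toFormula}
    {t : DTerm B b.toFormula} {t' : DTerm B b'.toFormula} (hs : HEq s s') (ht : HEq t t') :
    HEq ((a.prodComparison b).comp (s.times t)) ((a'.prodComparison b').comp (s'.times t')) := by
  subst ha hb hs ht
  rfl

theorem sumComparison_comp_heq {A B : Formula L} {a a' b b' : TopObj L} (ha : a = a')
    (hb : b = b') {s : DTerm A a.toFormula} {s' : DTerm A a'.toFormula}
    {t : DTerm B b.toFormula} {t' : DTerm B b'.toFormula} (hs : HEq s s') (ht : HEq t t') :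
    HEq ((a.sumComparison b).comp (s.plus t)) ((a'.sumComparison b').comp (s'.plus t')) := by
  subst ha hb hs ht
  rfl

/-- The target of the comparison is `A` only propositionally, so `t` is its transport to an
endo-term. It is the identity only up to `DEq`, being built from composites such as $\mathbf
1\circ(s\times t)$. -/
theorem Formula.comparison_of_iFree {A : Formula L} (hA : A.IFree) :
    ∃ t : DTerm A A, HEq A.comparison t ∧ DEq t (DTerm.one A) := by
  induction A with
  | letter p => exact ⟨_, HEq.rfl, .refl _⟩
  | I => exact hA.elim
  | O => exact ⟨_, HEq.rfl, .refl _⟩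
  | prod A B ihA ihB =>
    obtain ⟨s, hs, hs'⟩ := ihA hA.1
    obtain ⟨t, ht, ht'⟩ := ihB hA.2
    exact ⟨(DTerm.one _).comp (s.times t),
      -- At two old objects `prodComparison` is the identity by definition, which matches the outer
      -- factor of the witness.
      prodComparison_comp_heq (a' := some ⟨A, hA.1⟩) (b' := some ⟨B, hA.2⟩)
        (toTop_of_iFree hA.1) (toTop_of_iFree hA.2) hs ht,
      (DEq.one_comp _).trans ((DEq.times_congr hs' ht').trans (DEq.times_one _ _))⟩
  | sum A B ihA ihB =>
    obtain ⟨s, hs, hs'⟩ := ihA hA.1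
    obtain ⟨t, ht, ht'⟩ := ihB hA.2
    exact ⟨(DTerm.one _).comp (s.plus t),
      sumComparison_comp_heq (a' := some ⟨A, hA.1⟩) (b' := some ⟨B, hA.2⟩)
        (toTop_of_iFree hA.1) (toTop_of_iFree hA.2) hs ht,
      (DEq.one_comp _).trans ((DEq.plus_congr hs' ht').trans (DEq.plus_one _ _))⟩

theorem exists_sTerm_of_square {A B : Formula L} {hA : A.IFree} {hB : B.IFree} {a b : TopObj L}
    (ha : a = some ⟨A, hA⟩) (hb : b = some ⟨B, hB⟩) {f : DTerm A B} {x : TopTerm a b}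
    {s : DTerm A a.toFormula} {t : DTerm B b.toFormula} {s' : DTerm A A} {t' : DTerm B B}
    (hs : HEq s s') (ht : HEq t t') (hs' : DEq s' (DTerm.one A)) (ht' : DEq t' (DTerm.one B))
    (h : DEq (t.comp f) (x.toDTerm.comp s)) : ∃ g : STerm A B, DEq g.toDTerm f := by
  subst ha hb hs ht
  -- After the substitution `x` is itself a term of $\mathcal S$, and $x=x\circ\mathbf 1=x\circ
  -- s=t\circ f=\mathbf 1\circ f=f$.
  exact ⟨x, (DEq.comp_one _).symm.trans <| (DEq.comp_left _ hs'.symm).trans <|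
    h.symm.trans <| (DEq.comp_right ht' f).trans (DEq.one_comp f)⟩

/-- Every arrow term of the free dicartesian category between formulae without `I` is equal to an
arrow term of the free sesquicartesian category. -/
theorem DTerm.exists_sTerm {A B : Formula L} (hA : A.IFree) (hB : B.IFree) (f : DTerm A B) :
    ∃ g : STerm A B, DEq g.toDTerm f := by
  obtain ⟨s, hs, hs'⟩ := comparison_of_iFree hA
  obtain ⟨t, ht, ht'⟩ := comparison_of_iFree hB
  exact exists_sTerm_of_square (toTop_of_iFree hA) (toTop_of_iFree hB) hs ht hs' ht'
    f.comparison_naturality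

end

theorem mainTheorem6 (L : Type*) :
    Function.Injective (FreeSesquicartesian.inclusion L).obj ∧
      (∀ A : Formula L, A ∈ Set.range (FreeSesquicartesian.inclusion L).obj ↔ A.IFree) ∧
      (FreeSesquicartesian.inclusion L).Full ∧
      (FreeSesquicartesian.inclusion L).Faithful := by
  refine ⟨Subtype.val_injective, fun A => ⟨?_, fun hA => ⟨⟨A, hA⟩, rfl⟩⟩, ⟨?_⟩, ⟨?_⟩⟩
  · rintro ⟨B, rfl⟩
    exact B.2
  · intro A B f
    induction f using Quotient.inductionOn with
    | h f =>
      obtain ⟨g, hg⟩ := f.exists_sTerm A.2 B.2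
      exact ⟨Quotient.mk (sSetoid A.1 B.1) g, Quotient.sound hg⟩
  · intro A B f g
    induction f, g using Quotient.inductionOn₂ with
    | h f g =>
      intro h
      exact Quotient.sound (SEq.of_toDTerm (Quotient.exact h))
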